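/- For $n\ge 1$ let $p_n$ be the number of generalized partitions of $n$, i.e. of finite multisets $\{(v_1,w_1),\dots,(v_k,w_k)\}$ of pairs of positive integers with $\sum_{i=1}^k v_iw_i=n$. Let $d(\ell)$ be the number of positive divisors of $\ell$, and for integers $m\ge -1$ and real $\omega>0$ put $$S_m(\omega)=\sum_{k\ge 1}\sum_{\ell\mid k}\ell\, d(\ell)\,k^m e^{-k/\omega}.$$ These series converge absolutely; for every integer $n\ge 1$ the equation $S_0(\omega)=n$ has a unique solution $\omega=\omega(n)$ in $(0,\infty)$; and, as $n\to\infty$, $$p_n\sim\frac{1}{\sqrt{2\pi S_1(\omega)}}\exp\left(S_{-1}(\omega)+\frac n\omega\right),\qquad \omega=\omega(n),$$ where $a_n\sim b_n$ means $\lim_{n\to\infty}a_n/b_n=1$. -/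

import Mathlib

namespace GeneralizedPartition

/-- A generalized partition of `n`: a word `v₁^{w₁} ⋯ v_k^{w_k}` with positive integers `v_i, w_i`
and `∑ v_i w_i = n`, considered up to permutation of its letters `(v_i, w_i)`, that is, a finite
multiset of pairs of positive integers. -/
def IsGenPartition (n : ℕ) (s : Multiset (ℕ × ℕ)) : Prop :=
  (∀ x ∈ s, 0 < x.1 ∧ 0 < x.2) ∧ (s.map fun x => x.1 * x.2).sum = n

/-- The number `p_n` of generalized partitions of `n`. -/
noncomputable def p (n : ℕ) : ℕ := {s : Multiset (ℕ × ℕ) | IsGenPartition n s}.ncard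

/-- The `k`-th term `∑_{ℓ ∣ k} ℓ d(ℓ) k^m e^{-k/ω}` of the series `S_m(ω)`, where `d(ℓ)` is the
number of divisors of `ℓ`. For `k = 0` the sum is empty, so the term is `0`. -/
noncomputable def term (m : ℤ) (ω : ℝ) (k : ℕ) : ℝ :=
  ∑ l ∈ k.divisors, (l : ℝ) * (l.divisors.card : ℝ) * (k : ℝ) ^ m * Real.exp (-(k : ℝ) / ω)

/-- `S_m(ω) = ∑_{k ≥ 1} ∑_{ℓ ∣ k} ℓ d(ℓ) k^m e^{-k/ω}`. -/
noncomputable def S (m : ℤ) (ω : ℝ) : ℝ := ∑' k : ℕ, term m ω k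

end GeneralizedPartition

/-! This is a saddle-point argument on the circle of radius `q = e^{-1/ω}`. With `a_k = divWeight
k`, the generating function is `∑ p_n z^n = ∏ (1 - z^{vw})⁻¹ = exp (∑ a_k z^k / k)`. The product is
bypassed: counting gives `n p_n = ∑ a_k p_{n-k}` (`mul_p_eq_sum`), a differential equation for the
generating function, solved in `tsum_p_mul_pow_eq_exp`.

Cauchy's formula then gives `2π p_n e^{-n/ω} = e^{S_{-1}} ∫ exp (logChar ω θ) dθ` over `[-π, π]`;
the condition `S_0(ω) = n` is exactly what removes the term linear in `θ` from the exponent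
(`p_mul_exp_eq_integral`). Near `0`, `logChar` is `-S_1 θ²/2` up to `4 |θ|³ S_2`, so on `|θ| ≤ S_1 /
(16 S_2)` the substitution `u = √S_1 θ` and dominated convergence produce a Gaussian integral.
Elsewhere `a_k ≥ k` bounds the real part of `logChar` by an explicit geometric-cosine sum, which
makes the integrand exponentially small in `√ω`.

Only crude size estimates are needed: `S_1 ≥ ω³/2` and `S_m ≤ C ω^{m+9/4}`. An exponent `m + 2 + ε`
with `0 < ε < 1/2` suffices: convergence of `∑ a_k k^{-2-ε}` needs `ε > 0`, while `√S_1 · S_1/S_2 →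
∞` and the decay off the main arc need `ε < 1/2`. Here `ε = 1/4`. -/

namespace GeneralizedPartition

open Filter Topology

/-! ### The series `S_m`: convergence, size and monotonicity in `ω` -/

section

open Real

/-- `∑_{ℓ ∣ k} ℓ d(ℓ)`, the coefficient of the series `S_m`. -/
def divWeight (k : ℕ) : ℕ := ∑ l ∈ k.divisors, l * l.divisors.card

theorem divWeight_zero : divWeight 0 = 0 := by simp [divWeight]

theorem le_divWeight (k : ℕ) : k ≤ divWeight k := by
  rcases Nat.eq_zero_or_pos k with rfl | hk
  · simp
  · calc k ≤ k * k.divisors.card :=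
        Nat.le_mul_of_pos_right _ (Finset.card_pos.2 ⟨1, Nat.one_mem_divisors.2 hk.ne'⟩)
      _ ≤ divWeight k :=
        Finset.single_le_sum (f := fun l => l * l.divisors.card) (fun _ _ => Nat.zero_le _)
          (Nat.mem_divisors_self k hk.ne')

theorem term_eq (m : ℤ) (ω : ℝ) (k : ℕ) :
    term m ω k = divWeight k * (k : ℝ) ^ m * exp (-(k : ℝ) / ω) := by
  simp only [term, divWeight, Nat.cast_sum, Nat.cast_mul, Finset.sum_mul]

theorem term_zero (m : ℤ) (ω : ℝ) : term m ω 0 = 0 := by simp [term]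

theorem term_nonneg (m : ℤ) (ω : ℝ) (k : ℕ) : 0 ≤ term m ω k := by
  rw [term_eq]; positivity

theorem natCast_mul_term (m : ℤ) (ω : ℝ) (k : ℕ) : (k : ℝ) * term m ω k = term (m + 1) ω k := by
  rcases Nat.eq_zero_or_pos k with rfl | hk
  · simp [term_zero]
  · have : (k : ℝ) ≠ 0 := by positivity
    rw [term_eq, term_eq, zpow_add_one₀ this]; ring

/-- The Dirichlet series of `divWeight` is `ζ(s) ζ(s-1)²`, because `divWeight = ζ * (id * id)` as a
Dirichlet convolution; it converges absolutely for `s > 2`, in particular at `9/4`. -/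
theorem summable_divWeight_mul_rpow :
    Summable fun k : ℕ => (divWeight k : ℝ) * (k : ℝ) ^ (-(9 / 4) : ℝ) := by
  set I : ArithmeticFunction ℂ := ((ArithmeticFunction.id : ArithmeticFunction ℕ) :
    ArithmeticFunction ℂ) with hI
  set Z : ArithmeticFunction ℂ := ((ArithmeticFunction.zeta : ArithmeticFunction ℕ) :
    ArithmeticFunction ℂ) with hZ
  have hid : LSeriesSummable (fun n => I n) (9 / 4) :=
    LSeriesSummable_of_le_const_mul_rpow (x := 2) (by norm_num)
      ⟨1, fun n _ => by norm_num [hI]⟩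
  have hzeta : LSeriesSummable (fun n => Z n) (9 / 4) := by
    have := ArithmeticFunction.LSeriesSummable_zeta_iff.2 (show 1 < ((9 / 4 : ℂ)).re by norm_num)
    simpa [hZ] using this
  have hmul := ArithmeticFunction.LSeriesSummable_mul hzeta
    (ArithmeticFunction.LSeriesSummable_mul hid hid)
  have hval : ∀ k, (Z * (I * I)) k = divWeight k := fun k => by
    rw [hZ, ArithmeticFunction.coe_zeta_mul_apply, divWeight, Nat.cast_sum]
    -- Each divisor `d` of `l` contributes `d · (l/d) = l` to `(id * id) l`, so the total is `l
    -- d(l)`.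
    refine Finset.sum_congr rfl fun l _ => ?_
    rw [ArithmeticFunction.mul_apply, ← Nat.map_div_right_divisors, Finset.sum_map,
      Finset.sum_congr rfl (g := fun _ => (l : ℂ)) fun d hd => ?_]
    · simp [mul_comm]
    · have := Nat.mul_div_cancel' (Nat.dvd_of_mem_divisors hd)
      simp only [hI, ArithmeticFunction.natCoe_apply,
        ArithmeticFunction.id_apply]
      exact_mod_cast this
  refine hmul.norm.congr fun k => ?_
  rcases Nat.eq_zero_or_pos k with rfl | hk
  · simp [divWeight_zero]
  · rw [LSeries.norm_term_eq, if_neg hk.ne', hval, Real.rpow_neg (Nat.cast_nonneg _),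
      div_eq_mul_inv]
    norm_num

theorem rpow_le_mul_exp {s y : ℝ} (hs : 0 < s) (hy : 0 ≤ y) : y ^ s ≤ s ^ s * exp y := by
  have h : y ≤ s * exp (y / s) := by
    have := Real.add_one_le_exp (y / s)
    calc y = s * (y / s) := by field_simp
      _ ≤ s * exp (y / s) := by gcongr; linarith
  calc y ^ s ≤ (s * exp (y / s)) ^ s := Real.rpow_le_rpow hy h hs.le
    _ = s ^ s * exp y := by
      rw [Real.mul_rpow hs.le (exp_pos _).le, ← Real.exp_mul, div_mul_cancel₀ _ hs.ne']

/-- The exponential is traded for a power: `rpow_le_mul_exp` at `y = k/ω` and `s = m + 9/4`, which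
is positive for `m ≥ -1`. The dependence on `ω` becomes an explicit factor. -/
theorem term_le {m : ℤ} (hm : -1 ≤ m) {ω : ℝ} (hω : 0 < ω) (k : ℕ) :
    term m ω k ≤ ((m + 9 / 4 : ℝ) ^ (m + 9 / 4 : ℝ) * ω ^ (m + 9 / 4 : ℝ)) *
      (divWeight k * (k : ℝ) ^ (-(9 / 4) : ℝ)) := by
  rcases Nat.eq_zero_or_pos k with rfl | hk
  · simp [term_zero, divWeight_zero]
  have hk' : (0 : ℝ) < k := by exact_mod_cast hk
  have hm' : (-1 : ℝ) ≤ m := by exact_mod_cast hm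
  have hs : (0 : ℝ) < m + 9 / 4 := by linarith
  have h := rpow_le_mul_exp hs (div_nonneg hk'.le hω.le)
  rw [Real.div_rpow hk'.le hω.le, div_le_iff₀ (by positivity), Real.rpow_add hk',
    Real.rpow_intCast] at h
  have h2 : (k : ℝ) ^ m * exp (-(k : ℝ) / ω) ≤
      ((m + 9 / 4 : ℝ) ^ (m + 9 / 4 : ℝ) * ω ^ (m + 9 / 4 : ℝ)) * (k : ℝ) ^ (-(9 / 4) : ℝ) := by
    rw [neg_div, Real.exp_neg, Real.rpow_neg hk'.le, ← div_eq_mul_inv, ← div_eq_mul_inv,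
      div_le_div_iff₀ (exp_pos _) (by positivity)]
    linarith
  rw [term_eq, mul_assoc]
  calc _ ≤ (divWeight k : ℝ) * _ := mul_le_mul_of_nonneg_left h2 (Nat.cast_nonneg _)
    _ = _ := by ring

theorem summable_term {m : ℤ} (hm : -1 ≤ m) {ω : ℝ} (hω : 0 < ω) : Summable (term m ω) :=
  .of_nonneg_of_le (term_nonneg m ω) (term_le hm hω) (summable_divWeight_mul_rpow.mul_left _)

theorem exists_S_le {m : ℤ} (hm : -1 ≤ m) :
    ∃ C : ℝ, 0 < C ∧ ∀ ω : ℝ, 0 < ω → S m ω ≤ C * ω ^ (m + 9 / 4 : ℝ) := by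
  have hm' : (-1 : ℝ) ≤ m := by exact_mod_cast hm
  have hs : (0 : ℝ) < m + 9 / 4 := by linarith
  have hK : 0 ≤ ∑' k : ℕ, (divWeight k : ℝ) * (k : ℝ) ^ (-(9 / 4) : ℝ) :=
    tsum_nonneg fun k => by positivity
  refine ⟨(m + 9 / 4 : ℝ) ^ (m + 9 / 4 : ℝ) *
    (1 + ∑' k : ℕ, (divWeight k : ℝ) * (k : ℝ) ^ (-(9 / 4) : ℝ)), by positivity, fun ω hω => ?_⟩
  have h := (summable_term hm hω).tsum_le_tsum (term_le hm hω)
    (summable_divWeight_mul_rpow.mul_left _)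
  rw [tsum_mul_left] at h
  have h3 : (0 : ℝ) ≤ (m + 9 / 4 : ℝ) ^ (m + 9 / 4 : ℝ) * ω ^ (m + 9 / 4 : ℝ) := by positivity
  unfold S
  linarith

theorem S_mono_index {m : ℤ} (hm : -1 ≤ m) {ω : ℝ} (hω : 0 < ω) : S m ω ≤ S (m + 1) ω := by
  refine (summable_term hm hω).tsum_le_tsum (fun k => ?_) (summable_term (by lia) hω)
  rw [← natCast_mul_term]
  rcases Nat.eq_zero_or_pos k with rfl | hk
  · simp [term_zero]
  · exact le_mul_of_one_le_left (term_nonneg _ _ _) (by exact_mod_cast hk)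

/-- Since `a_k k ≥ k² ≥ (k+1).choose 2`, the series dominates `q ∑ (n+2).choose 2 * q^n = q /
(1-q)³`, where `1 - q ≤ 1/ω` and `q ≥ 1/2`. -/
theorem cube_le_S_one {ω : ℝ} (hω : 2 ≤ ω) : ω ^ 3 / 2 ≤ S 1 ω := by
  have hω0 : 0 < ω := by linarith
  set q := exp (-1 / ω) with hq
  have hq0 : 0 < q := exp_pos _
  have hq1 : q < 1 := by rw [hq, Real.exp_lt_one_iff]; exact div_neg_of_neg_of_pos (by norm_num) hω0
  have hq2 : 1 - 1 / ω ≤ q := by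
    have := Real.add_one_le_exp (-1 / ω)
    rw [neg_div] at this
    rw [hq, neg_div]; linarith
  have hω2 : 1 / ω ≤ 1 / 2 := one_div_le_one_div_of_le (by norm_num) hω
  have hsum := summable_choose_mul_geometric_of_norm_lt_one 2 (r := q)
    (by rwa [Real.norm_of_nonneg hq0.le])
  have ht := tsum_choose_mul_geometric_of_norm_lt_one 2 (r := q)
    (by rwa [Real.norm_of_nonneg hq0.le])
  have hS : S 1 ω = ∑' n : ℕ, term 1 ω (n + 1) := by
    rw [S, (summable_term (by norm_num) hω0).tsum_eq_zero_add, term_zero, zero_add]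
  have hle : q * ∑' n : ℕ, ((n + 2).choose 2 : ℝ) * q ^ n ≤ S 1 ω := by
    rw [hS, ← tsum_mul_left]
    refine (hsum.mul_left q).tsum_le_tsum (fun n => ?_)
      ((summable_nat_add_iff 1).2 (summable_term (by norm_num) hω0))
    have h1 : exp (-((n + 1 : ℕ) : ℝ) / ω) = q * q ^ n := by
      rw [← pow_succ', hq, ← Real.exp_nat_mul]; congr 1; ring
    have h2 : (((n + 2).choose 2 : ℕ) : ℝ) ≤ divWeight (n + 1) * ((n + 1 : ℕ) : ℝ) ^ (1 : ℤ) := by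
      rw [zpow_one]
      have h3 : (n + 2).choose 2 ≤ (n + 1) * (n + 1) := by
        rw [Nat.choose_two_right]
        apply Nat.div_le_of_le_mul
        simp only [Nat.add_succ_sub_one]
        nlinarith
      exact_mod_cast h3.trans (Nat.mul_le_mul_right _ (le_divWeight _))
    rw [term_eq, h1]
    calc _ = ((n + 2).choose 2 : ℝ) * (q * q ^ n) := by ring
      _ ≤ _ := by gcongr
  rw [ht] at hle
  have h1q : 0 < 1 - q := by linarith
  have h4 : ω ^ 3 ≤ 1 / (1 - q) ^ (2 + 1) := by
    rw [le_div_iff₀ (by positivity), ← mul_pow]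
    refine pow_le_one₀ (by positivity) ?_
    calc ω * (1 - q) ≤ ω * (1 / ω) := by gcongr; linarith
      _ = 1 := by field_simp
  have h5 : (0 : ℝ) ≤ ω ^ 3 := by positivity
  calc ω ^ 3 / 2 = 1 / 2 * ω ^ 3 := by ring
    _ ≤ q * (1 / (1 - q) ^ (2 + 1)) := by gcongr; linarith
    _ ≤ _ := hle

theorem continuousOn_S {m : ℤ} (hm : -1 ≤ m) : ContinuousOn (S m) (Set.Ioi 0) := by
  intro x hx
  have hx : 0 < x := hx
  refine ContinuousAt.continuousWithinAt ?_
  have hx1 : 0 < x + 1 := by linarith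
  refine ContinuousOn.continuousAt (s := Set.Ioo 0 (x + 1)) ?_
    (Ioo_mem_nhds hx (by linarith))
  refine continuousOn_tsum (u := term m (x + 1)) (fun k y hy => ?_) (summable_term hm hx1)
    fun k y hy => ?_
  · have : y ≠ 0 := hy.1.ne'
    simp only [term_eq]
    fun_prop (disch := assumption)
  · rw [Real.norm_of_nonneg (term_nonneg _ _ _), term_eq, term_eq]
    have : -(k : ℝ) / y ≤ -(k : ℝ) / (x + 1) := by
      rw [neg_div, neg_div, neg_le_neg_iff]
      exact div_le_div_of_nonneg_left (Nat.cast_nonneg _) hy.1 hy.2.le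
    gcongr

theorem strictMonoOn_S {m : ℤ} (hm : -1 ≤ m) : StrictMonoOn (S m) (Set.Ioi 0) := by
  intro x hx y hy hxy
  have hx : 0 < x := hx
  have hy : 0 < y := hy
  have hlt : ∀ k : ℕ, 0 < k → term m x k < term m y k := fun k hk => by
    rw [term_eq, term_eq]
    have hk' : (0 : ℝ) < k := by exact_mod_cast hk
    have ha : (0 : ℝ) < divWeight k := by exact_mod_cast hk.trans_le (le_divWeight k)
    have : -(k : ℝ) / x < -(k : ℝ) / y := by
      rw [neg_div, neg_div, neg_lt_neg_iff]
      exact div_lt_div_of_pos_left hk' hx hxy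
    gcongr
  refine Summable.tsum_lt_tsum (i := 1) (fun k => ?_) (hlt 1 one_pos) (summable_term hm hx)
    (summable_term hm hy)
  rcases Nat.eq_zero_or_pos k with rfl | hk
  · simp [term_zero]
  · exact (hlt k hk).le

theorem existsUnique_S_zero_eq {n : ℕ} (hn : 1 ≤ n) : ∃! ω : ℝ, 0 < ω ∧ S 0 ω = n := by
  have hn' : (1 : ℝ) ≤ n := by exact_mod_cast hn
  obtain ⟨C, hC, hS⟩ := exists_S_le (m := 0) (by norm_num)
  obtain ⟨x, hx0, hx⟩ : ∃ x : ℝ, 0 < x ∧ S 0 x ≤ n := by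
    have ht : Tendsto (fun x : ℝ => C * x ^ (((0 : ℤ) : ℝ) + 9 / 4 : ℝ)) (𝓝[>] 0) (𝓝 0) := by
      have := (Real.continuousAt_rpow_const 0 (((0 : ℤ) : ℝ) + 9 / 4) (Or.inr (by norm_num))).tendsto.const_mul C
      rw [Real.zero_rpow (by norm_num), mul_zero] at this
      exact this.mono_left nhdsWithin_le_nhds
    obtain ⟨x, hx, hx0⟩ :=
      ((ht.eventually (gt_mem_nhds one_pos)).and self_mem_nhdsWithin).exists
    exact ⟨x, hx0, (hS x hx0).trans (by linarith)⟩
  obtain ⟨y, hy0, hy⟩ : ∃ y : ℝ, 0 < y ∧ (n : ℝ) ≤ S 0 y := by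
    have h3 : (0 : ℝ) < (3 * n : ℕ) := by push_cast; linarith
    -- At `ω = 3n` the single term `k = 3n` is at least `3n/e`, which exceeds `n`.
    refine ⟨(3 * n : ℕ), h3, ?_⟩
    refine le_trans ?_ ((summable_term (by norm_num) h3).le_tsum (3 * n)
      fun _ _ => term_nonneg _ _ _)
    rw [term_eq, neg_div, div_self h3.ne', zpow_zero, mul_one, Real.exp_neg, ← div_eq_mul_inv,
      le_div_iff₀ (exp_pos _)]
    have h4 : ((3 * n : ℕ) : ℝ) ≤ divWeight (3 * n) := by exact_mod_cast le_divWeight _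
    have h5 := Real.exp_one_lt_d9
    push_cast at h4
    nlinarith
  have hcont : ContinuousOn (S 0) (Set.Ioi 0) := continuousOn_S (by norm_num)
  obtain ⟨ω, hω, hωn⟩ := (convex_Ioi (0 : ℝ)).isPreconnected.intermediate_value
    (a := x) (b := y) hx0 hy0 hcont ⟨hx, hy⟩
  exact ⟨ω, ⟨hω, hωn⟩, fun ω' h => (strictMonoOn_S (m := 0) (by norm_num)).injOn h.1 hω
    (h.2.trans hωn.symm)⟩

theorem tendsto_atTop_of_S_zero_eq {ω : ℕ → ℝ} (h : ∀ n : ℕ, 1 ≤ n → 0 < ω n ∧ S 0 (ω n) = n) :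
    Tendsto ω atTop atTop := by
  refine tendsto_atTop.2 fun b => ?_
  have hb : 0 < max b 1 := by positivity
  filter_upwards [eventually_ge_atTop 1, eventually_ge_atTop (Nat.ceil (S 0 (max b 1)))]
    with n hn hn'
  refine (le_max_left b 1).trans ?_
  by_contra! hlt
  have := strictMonoOn_S (m := 0) (by norm_num) (h n hn).1 hb hlt
  rw [(h n hn).2] at this
  exact absurd (Nat.ceil_le.1 hn') (not_le.2 this)

end

/-! ### Counting generalized partitions: finiteness and the recurrence for `p` -/

theorem IsGenPartition.mul_le {n : ℕ} {s : Multiset (ℕ × ℕ)} (h : IsGenPartition n s)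
    {x : ℕ × ℕ} (hx : x ∈ s) : x.1 * x.2 ≤ n := by
  rw [← h.2]
  exact Multiset.le_sum_of_mem (Multiset.mem_map_of_mem (fun x : ℕ × ℕ => x.1 * x.2) hx)

theorem IsGenPartition.card_le {n : ℕ} {s : Multiset (ℕ × ℕ)} (h : IsGenPartition n s) :
    s.card ≤ n := by
  have := Multiset.card_nsmul_le_sum (s := s.map fun x => x.1 * x.2) (a := 1) fun y hy => by
    obtain ⟨x, hx, rfl⟩ := Multiset.mem_map.1 hy
    exact Nat.mul_pos (h.1 x hx).1 (h.1 x hx).2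
  rw [h.2] at this
  simpa using this

theorem IsGenPartition.mem_box {n : ℕ} {s : Multiset (ℕ × ℕ)} (h : IsGenPartition n s)
    {x : ℕ × ℕ} (hx : x ∈ s) : x ∈ Finset.Icc 1 n ×ˢ Finset.Icc 1 n := by
  have h1 := h.1 x hx
  have h2 := h.mul_le hx
  simp only [Finset.mem_product, Finset.mem_Icc]
  exact ⟨⟨h1.1, (Nat.le_mul_of_pos_right _ h1.2).trans h2⟩,
    ⟨h1.2, (Nat.le_mul_of_pos_left _ h1.1).trans h2⟩⟩

theorem finite_isGenPartition (n : ℕ) : {s | IsGenPartition n s}.Finite := by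
  refine (Set.finite_Iic (n • (Finset.Icc 1 n ×ˢ Finset.Icc 1 n).val)).subset fun s hs => ?_
  rw [Set.mem_Iic, Multiset.le_iff_count]
  intro x
  by_cases hx : x ∈ s
  · rw [Multiset.count_nsmul, Multiset.count_eq_one_of_mem (Finset.nodup _)
      (IsGenPartition.mem_box hs hx), mul_one]
    exact (Multiset.count_le_card x s).trans hs.card_le
  · simp [Multiset.count_eq_zero_of_notMem hx]

/-- The finset of generalized partitions of `n`. -/
noncomputable def genPartitions (n : ℕ) : Finset (Multiset (ℕ × ℕ)) :=
  (finite_isGenPartition n).toFinset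

theorem mem_genPartitions {n : ℕ} {s : Multiset (ℕ × ℕ)} :
    s ∈ genPartitions n ↔ IsGenPartition n s := by simp [genPartitions]

theorem card_genPartitions (n : ℕ) : (genPartitions n).card = p n :=
  (Set.ncard_eq_toFinset_card _ (finite_isGenPartition n)).symm

theorem p_zero : p 0 = 1 := by
  rw [p, Set.ncard_eq_one]
  refine ⟨0, Set.ext fun s => ⟨fun h => ?_, ?_⟩⟩
  · exact Multiset.card_eq_zero.1 (Nat.le_zero.1 (IsGenPartition.card_le h))
  · rintro rfl
    simp [IsGenPartition]

/-- Removing `j` copies of the letter `x` is a bijection, with adding them back as inverse. -/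
theorem card_filter_le_count {n m j : ℕ} {x : ℕ × ℕ} (hx : 0 < x.1 ∧ 0 < x.2)
    (h : m + j * (x.1 * x.2) = n) :
    ((genPartitions n).filter fun s => j ≤ s.count x).card = p m := by
  rw [← card_genPartitions m]
  symm
  refine Finset.card_nbij' (fun t => t + Multiset.replicate j x)
    (fun s => s - Multiset.replicate j x) ?_ ?_ ?_ ?_
  · intro t ht
    have ht := mem_genPartitions.1 ht
    simp only [Finset.coe_filter, Set.mem_ofPred_eq, mem_genPartitions]
    refine ⟨⟨fun y hy => ?_, ?_⟩, ?_⟩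
    · rcases Multiset.mem_add.1 hy with hy | hy
      · exact ht.1 y hy
      · rw [Multiset.eq_of_mem_replicate hy]; exact hx
    · rw [Multiset.map_add, Multiset.sum_add, ht.2, Multiset.map_replicate,
        Multiset.sum_replicate, smul_eq_mul, h]
    · simp
  · intro s hs
    simp only [Finset.coe_filter, Set.mem_ofPred_eq, mem_genPartitions] at hs
    refine mem_genPartitions.2 ⟨fun y hy => hs.1.1 y
      (Multiset.mem_of_le (Multiset.sub_le_self _ _) hy), ?_⟩
    have h1 : s - Multiset.replicate j x + Multiset.replicate j x = s :=
      tsub_add_cancel_of_le (Multiset.le_count_iff_replicate_le.1 hs.2)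
    have h2 := hs.1.2
    rw [← h1, Multiset.map_add, Multiset.sum_add, Multiset.map_replicate,
        Multiset.sum_replicate, smul_eq_mul] at h2
    lia
  · intro t _
    simp
  · intro s hs
    simp only [Finset.coe_filter, Set.mem_ofPred_eq] at hs
    exact tsub_add_cancel_of_le (Multiset.le_count_iff_replicate_le.1 hs.2)

theorem filter_le_count_eq_empty {n j : ℕ} {x : ℕ × ℕ} (h : n < j * (x.1 * x.2)) :
    ((genPartitions n).filter fun s => j ≤ s.count x) = ∅ := by
  refine Finset.filter_eq_empty_iff.2 fun s hs hj => ?_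
  have hs := mem_genPartitions.1 hs
  have h1 : s - Multiset.replicate j x + Multiset.replicate j x = s :=
      tsub_add_cancel_of_le (Multiset.le_count_iff_replicate_le.1 hj)
  have h2 := hs.2
  rw [← h1, Multiset.map_add, Multiset.sum_add, Multiset.map_replicate,
        Multiset.sum_replicate, smul_eq_mul] at h2
  lia

/-- Triples `(v, w, j)` with `v w j = k`, weighted by `v w`. -/
theorem divWeight_eq_sum_triples {n k : ℕ} (hk : k ∈ Finset.Icc 1 n) :
    divWeight k = ∑ y ∈ ((Finset.Icc 1 n ×ˢ Finset.Icc 1 n) ×ˢ Finset.Icc 1 n) with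
      y.2 * (y.1.1 * y.1.2) = k, y.1.1 * y.1.2 := by
  obtain ⟨hk1, hkn⟩ := Finset.mem_Icc.1 hk
  have h1 : divWeight k = ∑ l ∈ k.divisors, ∑ _v ∈ l.divisors, l :=
    Finset.sum_congr rfl fun l _ => by simp [mul_comm]
  rw [h1, Finset.sum_sigma']
  -- A chain `v ∣ l ∣ k` corresponds to the triple `(v, l/v, k/l)`.
  refine Finset.sum_bij' (fun y _ => ((y.2, y.1 / y.2), k / y.1))
    (fun y _ => ⟨y.1.1 * y.1.2, y.1.1⟩) ?_ ?_ ?_ ?_ ?_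
  · rintro ⟨l, v⟩ h
    simp only [Finset.mem_sigma, Nat.mem_divisors] at h
    obtain ⟨⟨⟨j, rfl⟩, h0⟩, ⟨w, rfl⟩, h0'⟩ := h
    have hv : 0 < v := Nat.pos_of_ne_zero (by rintro rfl; simp at h0)
    have hw : 0 < w := Nat.pos_of_ne_zero (by rintro rfl; simp at h0)
    have hj : 0 < j := Nat.pos_of_ne_zero (by rintro rfl; simp at h0)
    simp only [Finset.mem_filter, Finset.mem_product, Finset.mem_Icc,
      Nat.mul_div_cancel_left _ hv, Nat.mul_div_cancel_left _ (Nat.mul_pos hv hw)]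
    have hvw : v ≤ v * w := Nat.le_mul_of_pos_right _ hw
    have hwv : w ≤ v * w := Nat.le_mul_of_pos_left _ hv
    have h3 : v * w ≤ v * w * j := Nat.le_mul_of_pos_right _ hj
    have h4 : j ≤ v * w * j := Nat.le_mul_of_pos_left _ (Nat.mul_pos hv hw)
    refine ⟨⟨⟨⟨hv, ?_⟩, hw, ?_⟩, hj, ?_⟩, by ring⟩ <;> lia
  · rintro ⟨⟨v, w⟩, j⟩ h
    simp only [Finset.mem_filter, Finset.mem_product, Finset.mem_Icc] at h
    simp only [Finset.mem_sigma, Nat.mem_divisors]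
    refine ⟨⟨⟨j, by rw [← h.2]; ring⟩, by lia⟩, ⟨w, rfl⟩, ?_⟩
    exact (Nat.mul_pos h.1.1.1.1 h.1.1.2.1).ne'
  · rintro ⟨l, v⟩ h
    simp only [Finset.mem_sigma, Nat.mem_divisors] at h
    simp only [Nat.mul_div_cancel' h.2.1]
  · rintro ⟨⟨v, w⟩, j⟩ h
    simp only [Finset.mem_filter, Finset.mem_product, Finset.mem_Icc] at h
    have hv : 0 < v := h.1.1.1.1
    have hw : 0 < w := h.1.1.2.1
    simp only [Nat.mul_div_cancel_left _ hv, ← h.2,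
      Nat.mul_div_cancel _ (Nat.mul_pos hv hw)]
  · rintro ⟨l, v⟩ h
    simp only [Finset.mem_sigma, Nat.mem_divisors] at h
    simp only [Nat.mul_div_cancel' h.2.1]

/-- Double counting of the total weight of all partitions of `n`. A letter `(v, w)` of multiplicity
`c` contributes `v w` once for each `j = 1, …, c`; for fixed `(v, w, j)` exactly `p (n - j v w)`
partitions contain at least `j` copies. Grouping by `k = j v w` gives `divWeight k`. -/
theorem mul_p_eq_sum (n : ℕ) : n * p n = ∑ k ∈ Finset.Icc 1 n, divWeight k * p (n - k) := by
  set B := Finset.Icc 1 n ×ˢ Finset.Icc 1 n with hB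
  have hcount : ∀ s ∈ genPartitions n,
      n = ∑ y ∈ B ×ˢ Finset.Icc 1 n, if y.2 ≤ s.count y.1 then y.1.1 * y.1.2 else 0 := by
    intro s hs
    have hs := mem_genPartitions.1 hs
    have hsub : s.toFinset ⊆ B := fun x hx => hs.mem_box (Multiset.mem_toFinset.1 hx)
    conv_lhs => rw [← hs.2, Finset.sum_multiset_map_count]
    rw [Finset.sum_product, Finset.sum_subset hsub fun x _ hx => by
      rw [Multiset.count_eq_zero_of_notMem (fun h => hx (Multiset.mem_toFinset.2 h)), zero_smul]]
    refine Finset.sum_congr rfl fun x _ => ?_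
    dsimp only
    rw [← Finset.sum_filter, Finset.sum_const]
    congr 1
    have : (Finset.Icc 1 n).filter (fun j => j ≤ s.count x) = Finset.Icc 1 (s.count x) := by
      have := (Multiset.count_le_card x s).trans hs.card_le
      ext j
      simp only [Finset.mem_filter, Finset.mem_Icc]
      lia
    rw [this]; simp
  calc n * p n = ∑ s ∈ genPartitions n, n := by
        rw [Finset.sum_const, card_genPartitions, smul_eq_mul, mul_comm]
    _ = ∑ s ∈ genPartitions n, ∑ y ∈ B ×ˢ Finset.Icc 1 n,
          if y.2 ≤ s.count y.1 then y.1.1 * y.1.2 else 0 := Finset.sum_congr rfl hcount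
    _ = ∑ y ∈ B ×ˢ Finset.Icc 1 n, if y.2 * (y.1.1 * y.1.2) ≤ n then
          y.1.1 * y.1.2 * p (n - y.2 * (y.1.1 * y.1.2)) else 0 := by
        rw [Finset.sum_comm]
        refine Finset.sum_congr rfl fun y hy => ?_
        simp only [hB, Finset.mem_product, Finset.mem_Icc] at hy
        rw [← Finset.sum_filter, Finset.sum_const, smul_eq_mul, mul_comm]
        split_ifs with h
        · rw [card_filter_le_count ⟨hy.1.1.1, hy.1.2.1⟩ (Nat.sub_add_cancel h)]
        · rw [filter_le_count_eq_empty (not_le.1 h), Finset.card_empty, mul_zero]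
    _ = ∑ k ∈ Finset.Icc 1 n, divWeight k * p (n - k) := by
        rw [← Finset.sum_filter, ← Finset.sum_fiberwise_of_maps_to (t := Finset.Icc 1 n)
          (g := fun y => y.2 * (y.1.1 * y.1.2))]
        · refine Finset.sum_congr rfl fun k hk => ?_
          rw [divWeight_eq_sum_triples hk, Finset.sum_mul, Finset.filter_filter]
          refine Finset.sum_congr ?_ fun y hy => ?_
          · refine Finset.filter_congr fun y _ => ⟨fun h => h.2, fun h => ⟨?_, h⟩⟩
            rw [h]; exact (Finset.mem_Icc.1 hk).2
          · rw [(Finset.mem_filter.1 hy).2]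
        · intro y hy
          simp only [hB, Finset.mem_filter, Finset.mem_product, Finset.mem_Icc] at hy
          exact Finset.mem_Icc.2
            ⟨Nat.mul_pos hy.1.2.1 (Nat.mul_pos hy.1.1.1.1 hy.1.1.2.1), hy.2⟩

theorem succ_mul_p_succ (n : ℕ) : (n + 1) * p (n + 1) =
    ∑ y ∈ Finset.HasAntidiagonal.antidiagonal n, divWeight (y.1 + 1) * p y.2 := by
  have h := Finset.sum_Ico_add' (fun k => divWeight k * p (n + 1 - k)) 0 (n + 1) 1
  simp only [Nat.add_sub_add_right, zero_add] at h
  rw [mul_p_eq_sum, Finset.Nat.sum_antidiagonal_eq_sum_range_succ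
    (fun i j => divWeight (i + 1) * p j), Finset.range_eq_Ico]
  exact h.symm

/-! ### The generating function in the unit disc -/

theorem summable_divWeight_mul_pow {ρ : ℝ} (h0 : 0 < ρ) (h1 : ρ < 1) :
    Summable fun k => (divWeight k : ℝ) * ρ ^ k := by
  have hlog : Real.log ρ < 0 := Real.log_neg h0 h1
  refine (summable_term (m := 0) (by norm_num)
    (show 0 < (-Real.log ρ)⁻¹ by rw [inv_pos]; linarith)).congr fun k => ?_
  rw [term_eq, zpow_zero, mul_one, div_inv_eq_mul, neg_mul_neg, Real.exp_nat_mul, Real.exp_log h0]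

/-- Strong induction on the recurrence: if earlier values of `p m * ρ ^ m` are at most `M`, then `n
p_n ρ^n ≤ B M`, which is at most `n M` once `n ≥ B`. Hence `M` only has to cover the initial indices
up to `⌈B⌉₊`. -/
theorem exists_p_mul_pow_le {ρ : ℝ} (h0 : 0 < ρ) (h1 : ρ < 1) :
    ∃ M : ℝ, ∀ n, (p n : ℝ) * ρ ^ n ≤ M := by
  set B := ∑' k, (divWeight k : ℝ) * ρ ^ k with hB
  set N := ⌈B⌉₊ with hN
  set M := ∑ m ∈ Finset.range (N + 1), (p m : ℝ) * ρ ^ m with hM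
  have hM0 : 0 ≤ M := Finset.sum_nonneg fun m _ => by positivity
  refine ⟨M, fun n => ?_⟩
  induction n using Nat.strong_induction_on with
  | _ n ih =>
    by_cases hn : n ≤ N
    · exact Finset.single_le_sum (f := fun m => (p m : ℝ) * ρ ^ m) (fun m _ => by positivity)
        (Finset.mem_range.2 (Nat.lt_succ_of_le hn))
    · have hBn : B ≤ n := (Nat.le_ceil B).trans (by exact_mod_cast (not_le.1 hn).le)
      have hn0 : (0 : ℝ) < n := by exact_mod_cast (Nat.zero_le N).trans_lt (not_le.1 hn)
      have hrec : (n : ℝ) * p n = ∑ k ∈ Finset.Icc 1 n, (divWeight k : ℝ) * p (n - k) := by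
        exact_mod_cast mul_p_eq_sum n
      have : (n : ℝ) * (p n * ρ ^ n) ≤ n * M := by
        calc (n : ℝ) * (p n * ρ ^ n)
            = ∑ k ∈ Finset.Icc 1 n, ((divWeight k : ℝ) * ρ ^ k) * (p (n - k) * ρ ^ (n - k)) := by
              rw [← mul_assoc, hrec, Finset.sum_mul]
              refine Finset.sum_congr rfl fun k hk => ?_
              rw [← Nat.add_sub_of_le (Finset.mem_Icc.1 hk).2, pow_add]
              simp only [Nat.add_sub_cancel_left]; ring
          _ ≤ ∑ k ∈ Finset.Icc 1 n, ((divWeight k : ℝ) * ρ ^ k) * M := by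
              refine Finset.sum_le_sum fun k hk => ?_
              have := ih (n - k) (by have := Finset.mem_Icc.1 hk; lia)
              gcongr
          _ ≤ B * M := by
              rw [← Finset.sum_mul]
              gcongr
              exact (summable_divWeight_mul_pow h0 h1).sum_le_tsum _ fun k _ => by positivity
          _ ≤ n * M := by gcongr
      exact le_of_mul_le_mul_left this hn0

theorem summable_mul_p_mul_pow {ρ : ℝ} (h0 : 0 < ρ) (h1 : ρ < 1) :
    Summable fun n : ℕ => (n : ℝ) * p n * ρ ^ n := by
  obtain ⟨σ, hρσ, hσ1⟩ := exists_between h1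
  have hσ0 : 0 < σ := h0.trans hρσ
  obtain ⟨M, hM⟩ := exists_p_mul_pow_le hσ0 hσ1
  have hlt : ‖ρ / σ‖ < 1 := by
    rw [Real.norm_of_nonneg (by positivity), div_lt_one hσ0]; exact hρσ
  refine .of_nonneg_of_le (fun n => by positivity) (fun n => ?_)
    ((summable_pow_mul_geometric_of_norm_lt_one 1 hlt).mul_left M)
  calc (n : ℝ) * p n * ρ ^ n = (p n * σ ^ n) * (n ^ 1 * (ρ / σ) ^ n) := by
        rw [div_pow]; field_simp
    _ ≤ M * (n ^ 1 * (ρ / σ) ^ n) := by gcongr; exact hM n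

theorem summable_p_mul_pow {ρ : ℝ} (h0 : 0 < ρ) (h1 : ρ < 1) :
    Summable fun n : ℕ => (p n : ℝ) * ρ ^ n := by
  refine (summable_nat_add_iff 1).1 (.of_nonneg_of_le (fun n => by positivity) (fun n => ?_)
    ((summable_nat_add_iff 1).2 (summable_mul_p_mul_pow h0 h1)))
  rw [mul_assoc]
  exact le_mul_of_one_le_left (by positivity) (by push_cast; linarith [Nat.cast_nonneg (α := ℝ) n])

/-- Termwise differentiation of a power series inside the unit disc. -/
theorem hasDerivAt_tsum_mul_pow {c : ℕ → ℂ}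
    (hc : ∀ ρ : ℝ, 0 < ρ → ρ < 1 → Summable fun n : ℕ => (n : ℝ) * ‖c n‖ * ρ ^ n)
    {z : ℂ} (hz : ‖z‖ < 1) :
    HasDerivAt (fun z => ∑' n, c n * z ^ n) (∑' n : ℕ, (n + 1) * c (n + 1) * z ^ n) z := by
  obtain ⟨ρ, hzρ, hρ1⟩ := exists_between hz
  have hρ0 : 0 < ρ := (norm_nonneg z).trans_lt hzρ
  have hu : Summable fun n : ℕ => (n : ℝ) * ‖c n‖ * ρ ^ (n - 1) := by
    refine ((hc ρ hρ0 hρ1).mul_right ρ⁻¹).congr fun n => ?_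
    rcases n with - | n
    · simp
    · rw [Nat.add_sub_cancel, pow_succ]; field_simp
  have hbound : ∀ (n : ℕ), ∀ y ∈ Metric.ball (0 : ℂ) ρ,
      ‖c n * (n * y ^ (n - 1))‖ ≤ n * ‖c n‖ * ρ ^ (n - 1) := fun n y hy => by
    rw [norm_mul, norm_mul, norm_pow, Complex.norm_natCast]
    have : ‖y‖ ≤ ρ := (mem_ball_zero_iff.1 hy).le
    calc _ = n * ‖c n‖ * ‖y‖ ^ (n - 1) := by ring
      _ ≤ _ := by gcongr
  have hzb : z ∈ Metric.ball (0 : ℂ) ρ := mem_ball_zero_iff.2 hzρ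
  have h := hasDerivAt_tsum_of_isPreconnected (g := fun n y => c n * y ^ n)
    (g' := fun n y => c n * (n * y ^ (n - 1))) (y₀ := 0) hu Metric.isOpen_ball
    (convex_ball (0 : ℂ) ρ).isPreconnected
    (fun n y _ => (hasDerivAt_pow n y).const_mul (c n)) hbound (Metric.mem_ball_self hρ0)
    (summable_of_ne_finset_zero (s := {0}) fun n hn => by
      simp [Finset.notMem_singleton.1 hn]) hzb
  refine h.congr_deriv ?_
  -- The truncated exponent `n - 1` is harmless at `n = 0`, where the factor `n` vanishes; dropping
  -- that term shifts the index.
  rw [(Summable.of_norm_bounded hu fun n => hbound n z hzb).tsum_eq_zero_add]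
  simp only [Nat.cast_zero, zero_mul, mul_zero, zero_add, Nat.add_sub_cancel, Nat.cast_add,
    Nat.cast_one]
  exact tsum_congr fun n => by ring

/-- The recurrence says `F' = A' F` for the two power series, so `F e^{-A}` has zero derivative on
the disc and keeps its value `1` at the origin. The constant coefficient of `A` is `0 / 0 = 0`. -/
theorem tsum_p_mul_pow_eq_exp {z : ℂ} (hz : ‖z‖ < 1) :
    ∑' n, (p n : ℂ) * z ^ n = Complex.exp (∑' n : ℕ, (divWeight n / n : ℂ) * z ^ n) := by
  have hF : ∀ z : ℂ, ‖z‖ < 1 → HasDerivAt (fun z => ∑' n, (p n : ℂ) * z ^ n)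
      (∑' n : ℕ, (n + 1) * ((p (n + 1) : ℕ) : ℂ) * z ^ n) z := fun z hz =>
    hasDerivAt_tsum_mul_pow (c := fun n => (p n : ℂ))
      (fun ρ h0 h1 => by simpa using summable_mul_p_mul_pow h0 h1) hz
  have hL : ∀ z : ℂ, ‖z‖ < 1 → HasDerivAt (fun z => ∑' n : ℕ, (divWeight n / n : ℂ) * z ^ n)
      (∑' n : ℕ, ((divWeight (n + 1) : ℕ) : ℂ) * z ^ n) z := fun z hz => by
    have h := hasDerivAt_tsum_mul_pow (c := fun n : ℕ => (divWeight n / n : ℂ))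
      (fun ρ h0 h1 => by
        refine (summable_divWeight_mul_pow h0 h1).congr fun n => ?_
        rcases Nat.eq_zero_or_pos n with rfl | hn
        · simp [divWeight_zero]
        · rw [norm_div, Complex.norm_natCast, Complex.norm_natCast]
          field_simp) hz
    convert h using 1
    refine tsum_congr fun n => ?_
    have : (n + 1 : ℂ) ≠ 0 := Nat.cast_add_one_ne_zero n
    push_cast
    field_simp
  have hmul : ∀ z : ℂ, ‖z‖ < 1 → ∑' n : ℕ, (n + 1) * ((p (n + 1) : ℕ) : ℂ) * z ^ n =
      (∑' n : ℕ, ((divWeight (n + 1) : ℕ) : ℂ) * z ^ n) * ∑' n, (p n : ℂ) * z ^ n := by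
    intro z hz
    obtain ⟨ρ, hzρ, hρ1⟩ := exists_between hz
    have hρ0 : 0 < ρ := (norm_nonneg z).trans_lt hzρ
    rw [tsum_mul_tsum_eq_tsum_sum_antidiagonal_of_summable_norm]
    · refine tsum_congr fun n => ?_
      have : ((n + 1 : ℂ)) * ((p (n + 1) : ℕ) : ℂ) =
          ∑ y ∈ Finset.HasAntidiagonal.antidiagonal n, ((divWeight (y.1 + 1) : ℕ) : ℂ) * p y.2 := by
        exact_mod_cast succ_mul_p_succ n
      rw [this, Finset.sum_mul]
      refine Finset.sum_congr rfl fun y hy => ?_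
      rw [← Finset.HasAntidiagonal.mem_antidiagonal.1 hy, pow_add]
      ring
    · refine .of_nonneg_of_le (fun _ => norm_nonneg _) (fun n => ?_)
        (((summable_nat_add_iff 1).2 (summable_divWeight_mul_pow hρ0 hρ1)).mul_right ρ⁻¹)
      rw [norm_mul, norm_pow, Complex.norm_natCast, pow_succ, ← mul_assoc,
        mul_inv_cancel_right₀ hρ0.ne']
      gcongr
    · refine .of_nonneg_of_le (fun _ => norm_nonneg _) (fun n => ?_) (summable_p_mul_pow hρ0 hρ1)
      rw [norm_mul, norm_pow, Complex.norm_natCast]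
      gcongr
  set F : ℂ → ℂ := fun z => ∑' n, (p n : ℂ) * z ^ n with hFdef
  set A : ℂ → ℂ := fun z => ∑' n : ℕ, (divWeight n / n : ℂ) * z ^ n with hAdef
  have hG : ∀ z ∈ Metric.ball (0 : ℂ) 1, HasDerivAt (fun z => F z * Complex.exp (-A z)) 0 z := by
    intro z hz
    have hz := mem_ball_zero_iff.1 hz
    refine ((hF z hz).mul (hL z hz).neg.cexp).congr_deriv ?_
    rw [hmul z hz]
    ring
  have hconst := Metric.isOpen_ball.is_const_of_deriv_eq_zero
    (convex_ball (0 : ℂ) 1).isPreconnected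
    (fun z hz => (hG z hz).differentiableAt.differentiableWithinAt)
    (fun z hz => (hG z hz).deriv) (mem_ball_zero_iff.2 hz) (Metric.mem_ball_self one_pos)
  have hF0 : F 0 = 1 := by
    rw [hFdef]
    simp only
    rw [tsum_eq_single 0 fun n hn => by simp [hn]]
    simp [p_zero]
  have hA0 : A 0 = 0 := by
    rw [hAdef]
    simp only
    rw [tsum_eq_single 0 fun n hn => by simp [hn]]
    simp
  rw [hF0, hA0, neg_zero, Complex.exp_zero, mul_one, Complex.exp_neg] at hconst
  exact (mul_inv_eq_one₀ (Complex.exp_ne_zero _)).1 hconst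

/-! ### Coefficient extraction and the centred exponent `logChar` -/

theorem integral_exp_int_mul_I (m : ℤ) :
    ∫ θ in -Real.pi..Real.pi, Complex.exp (m * Complex.I * θ) =
      if m = 0 then (2 * Real.pi : ℂ) else 0 := by
  split_ifs with h
  · simp [h]; ring
  · have hm : (m : ℂ) * Complex.I ≠ 0 := mul_ne_zero (by exact_mod_cast h) Complex.I_ne_zero
    rw [integral_exp_mul_complex hm]
    have : (m : ℂ) * Complex.I * Real.pi =
        m * Complex.I * (-Real.pi : ℝ) + m * (2 * Real.pi * Complex.I) := by
      push_cast; ring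
    rw [this, Complex.exp_add, Complex.exp_int_mul_two_pi_mul_I, mul_one, sub_self, zero_div]

/-- The coefficients of an absolutely convergent power series as integrals over a circle. -/
theorem integral_tsum_mul_pow {c : ℕ → ℂ} {q : ℝ} (hc : Summable fun m => ‖c m‖ * |q| ^ m) (n : ℕ) :
    ∫ θ in -Real.pi..Real.pi, (∑' m, c m * (q * Complex.exp (θ * Complex.I)) ^ m) *
      Complex.exp (-(n * θ * Complex.I)) = 2 * Real.pi * (c n * q ^ n) := by
  have hterm : ∀ (m : ℕ) (θ : ℝ), c m * (q * Complex.exp (θ * Complex.I)) ^ m *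
      Complex.exp (-(n * θ * Complex.I)) =
      c m * q ^ m * Complex.exp (((m - n : ℤ) : ℂ) * Complex.I * θ) := fun m θ => by
    rw [mul_pow, ← Complex.exp_nat_mul, ← mul_assoc, mul_assoc _ (Complex.exp _), ← Complex.exp_add]
    congr 2
    push_cast; ring
  have hnorm : ∀ (m : ℕ) (θ : ℝ), ‖c m * (q * Complex.exp (θ * Complex.I)) ^ m *
      Complex.exp (-(n * θ * Complex.I))‖ ≤ ‖c m‖ * |q| ^ m := fun m θ => by
    have h1 : (-(n * θ * Complex.I) : ℂ) = ((-(n * θ) : ℝ) : ℂ) * Complex.I := by push_cast; ring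
    rw [h1, norm_mul, norm_mul, norm_pow, norm_mul, Complex.norm_exp_ofReal_mul_I,
      Complex.norm_exp_ofReal_mul_I, Complex.norm_real, Real.norm_eq_abs]
    simp
  have hs := intervalIntegral.hasSum_integral_of_dominated_convergence
    (μ := MeasureTheory.volume) (a := -Real.pi) (b := Real.pi)
    (F := fun m (θ : ℝ) => c m * (q * Complex.exp (θ * Complex.I)) ^ m *
      Complex.exp (-(n * θ * Complex.I)))
    (f := fun θ : ℝ => (∑' m, c m * (q * Complex.exp (θ * Complex.I)) ^ m) *
      Complex.exp (-(n * θ * Complex.I)))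
    (fun m _ => ‖c m‖ * |q| ^ m)
    (fun m => Continuous.aestronglyMeasurable (by fun_prop))
    (fun m => .of_forall fun θ _ => hnorm m θ) (.of_forall fun _ _ => hc)
    intervalIntegrable_const
    (.of_forall fun θ _ => by
      rw [← tsum_mul_right]
      exact (Summable.of_norm_bounded hc fun m => hnorm m θ).hasSum)
  rw [← hs.tsum_eq, tsum_eq_single n]
  · simp only [hterm, intervalIntegral.integral_const_mul, integral_exp_int_mul_I]
    simp; ring
  · intro m hm
    simp only [hterm, intervalIntegral.integral_const_mul, integral_exp_int_mul_I]
    rw [if_neg (by lia), mul_zero]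

/-- The logarithm of the characteristic function of the centred random weight. -/
noncomputable def logChar (ω θ : ℝ) : ℂ :=
  ∑' k : ℕ, (term (-1) ω k : ℂ) * (Complex.exp (k * θ * Complex.I) - 1 - k * θ * Complex.I)

theorem norm_exp_natCast_mul_I (k : ℕ) (θ : ℝ) : ‖Complex.exp (k * θ * Complex.I)‖ = 1 := by
  have : (k * θ * Complex.I : ℂ) = ((k * θ : ℝ) : ℂ) * Complex.I := by push_cast; ring
  rw [this, Complex.norm_exp_ofReal_mul_I]

theorem norm_term_mul_exp (ω θ : ℝ) (k : ℕ) :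
    ‖(term (-1) ω k : ℂ) * Complex.exp (k * θ * Complex.I)‖ = term (-1) ω k := by
  rw [norm_mul, norm_exp_natCast_mul_I, mul_one, Complex.norm_real,
    Real.norm_of_nonneg (term_nonneg _ _ _)]

theorem hasSum_logChar {ω : ℝ} (hω : 0 < ω) (θ : ℝ) :
    HasSum (fun k : ℕ => (term (-1) ω k : ℂ) *
        (Complex.exp (k * θ * Complex.I) - 1 - k * θ * Complex.I))
        (∑' k : ℕ, (term (-1) ω k : ℂ) * Complex.exp (k * θ * Complex.I) - S (-1) ω -
          S 0 ω * (θ * Complex.I)) := by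
  have hs1 : Summable (term (-1) ω) := summable_term (by norm_num) hω
  have hs0 : Summable (term 0 ω) := summable_term (by norm_num) hω
  have hse : Summable fun k : ℕ => (term (-1) ω k : ℂ) * Complex.exp (k * θ * Complex.I) :=
    .of_norm_bounded hs1 fun k => (norm_term_mul_exp ω θ k).le
  have hs1' : HasSum (fun k => (term (-1) ω k : ℂ)) (S (-1) ω : ℂ) :=
    Complex.hasSum_ofReal.2 hs1.hasSum
  have hs0' : HasSum (fun k => (term 0 ω k : ℂ)) (S 0 ω : ℂ) :=
    Complex.hasSum_ofReal.2 hs0.hasSum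
  refine Eq.subst (motive := fun f => HasSum f _) (funext fun k => ?_)
    ((hse.hasSum.sub hs1').sub (hs0'.mul_right (θ * Complex.I)))
  have := natCast_mul_term (-1) ω k
  rw [show (-1 : ℤ) + 1 = 0 by norm_num] at this
  rw [← this]
  push_cast
  ring

theorem continuous_logChar {ω : ℝ} (hω : 0 < ω) : Continuous (logChar ω) := by
  have h : logChar ω = fun θ : ℝ =>
      ∑' k : ℕ, (term (-1) ω k : ℂ) * Complex.exp (k * θ * Complex.I) - S (-1) ω -
        S 0 ω * (θ * Complex.I) := funext fun θ => (hasSum_logChar hω θ).tsum_eq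
  have hc : Continuous fun θ : ℝ =>
      ∑' k : ℕ, (term (-1) ω k : ℂ) * Complex.exp (k * θ * Complex.I) :=
    continuous_tsum (fun k => by fun_prop) (summable_term (by norm_num) hω)
      fun k θ => (norm_term_mul_exp ω θ k).le
  rw [h]
  fun_prop

/-- Cauchy's formula on `|z| = q`. By `hasSum_logChar` the logarithm of the integrand is `S_{-1} +
logChar + i θ (S_0 - n)`, and the last term vanishes. -/
theorem p_mul_exp_eq_integral {ω : ℝ} (hω : 0 < ω) {n : ℕ} (hn : S 0 ω = n) :
    (2 * Real.pi * (p n * Real.exp (-n / ω)) : ℂ) =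
      Complex.exp (S (-1) ω) * ∫ θ in -Real.pi..Real.pi, Complex.exp (logChar ω θ) := by
  set q := Real.exp (-1 / ω) with hq
  have hq0 : 0 < q := Real.exp_pos _
  have hq1 : q < 1 := by
    rw [hq, Real.exp_lt_one_iff]; exact div_neg_of_neg_of_pos (by norm_num) hω
  have hqn : ∀ k : ℕ, Real.exp (-k / ω) = q ^ k := fun k => by
    rw [hq, ← Real.exp_nat_mul]; congr 1; ring
  have hint := integral_tsum_mul_pow (c := fun m => (p m : ℂ)) (q := q)
    (by simpa [abs_of_pos hq0] using summable_p_mul_pow hq0 hq1) n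
  have hlog : ∀ θ : ℝ, (∑' m, (p m : ℂ) * (q * Complex.exp (θ * Complex.I)) ^ m) *
      Complex.exp (-(n * θ * Complex.I)) =
      Complex.exp (S (-1) ω) * Complex.exp (logChar ω θ) := fun θ => by
    rw [tsum_p_mul_pow_eq_exp (by
      rw [norm_mul, Complex.norm_exp_ofReal_mul_I, mul_one, Complex.norm_real,
        Real.norm_of_nonneg hq0.le]; exact hq1), ← Complex.exp_add, ← Complex.exp_add]
    congr 1
    have e1 : ∀ k : ℕ, (divWeight k / k : ℂ) * (q * Complex.exp (θ * Complex.I)) ^ k =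
        (term (-1) ω k : ℂ) * Complex.exp (k * θ * Complex.I) := fun k => by
      rw [term_eq, hqn, mul_pow, ← Complex.exp_nat_mul]
      push_cast
      rw [zpow_neg_one, mul_assoc (k : ℂ)]
      ring
    rw [logChar, (hasSum_logChar hω θ).tsum_eq, tsum_congr e1, hn, Complex.ofReal_natCast]
    ring
  simp only [hlog, intervalIntegral.integral_const_mul] at hint
  rw [hint, hqn]
  push_cast
  ring

/-! ### Estimates for `logChar`: Gaussian approximation and decay -/

theorem norm_exp_mul_I_sub_le (x : ℝ) :
    ‖Complex.exp (x * Complex.I) - 1 - x * Complex.I + x ^ 2 / 2‖ ≤ 4 * |x| ^ 3 := by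
  have hI : ‖(x * Complex.I : ℂ)‖ = |x| := by simp
  have hx0 : 0 ≤ |x| := abs_nonneg x
  rcases le_total |x| 1 with hx | hx
  · have h := Complex.exp_bound (x := x * Complex.I) (by rwa [hI]) (n := 3) (by norm_num)
    rw [hI] at h
    have e : Complex.exp (x * Complex.I) - ∑ m ∈ Finset.range 3, (x * Complex.I) ^ m / m.factorial =
        Complex.exp (x * Complex.I) - 1 - x * Complex.I + x ^ 2 / 2 := by
      simp only [Finset.sum_range_succ, Finset.sum_range_zero, mul_pow, Complex.I_sq]
      simp [Nat.factorial]
      ring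
    rw [e] at h
    refine h.trans ?_
    rw [mul_comm]
    gcongr
    norm_num [Nat.factorial]
  · have h2 : ‖((x : ℂ) ^ 2 / 2)‖ = |x| ^ 2 / 2 := by simp
    have h1 : ‖Complex.exp (x * Complex.I) - 1 - x * Complex.I + x ^ 2 / 2‖ ≤
        1 + 1 + |x| + |x| ^ 2 / 2 := by
      refine (norm_add_le _ _).trans (add_le_add ((norm_sub_le _ _).trans (add_le_add
        ((norm_sub_le _ _).trans (add_le_add ?_ ?_)) hI.le)) h2.le)
      · rw [Complex.norm_exp_ofReal_mul_I]
      · simp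
    -- For `|x| ≥ 1` the trivial bound `2 + |x| + x²/2` is at most `(7/2) |x|³`, whence the constant
    -- `4`.
    have h3 : |x| ≤ |x| ^ 3 := le_self_pow₀ hx (by norm_num)
    have h4 : |x| ^ 2 ≤ |x| ^ 3 := pow_le_pow_right₀ hx (by norm_num)
    linarith

theorem S_pos {m : ℤ} (hm : -1 ≤ m) {ω : ℝ} (hω : 0 < ω) : 0 < S m ω :=
  (summable_term hm hω).tsum_pos (term_nonneg m ω) 1 (by
    have : (0 : ℝ) < divWeight 1 := by exact_mod_cast le_divWeight 1
    rw [term_eq]; positivity)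

/-- Second-order Taylor expansion at `x = kθ` in each term; the powers `k²` and `k³` raise the index
of `term (-1)` to `1` and `2`. -/
theorem norm_logChar_add_le {ω : ℝ} (hω : 0 < ω) (θ : ℝ) :
    ‖logChar ω θ + S 1 ω * θ ^ 2 / 2‖ ≤ 4 * |θ| ^ 3 * S 2 ω := by
  have h1 : HasSum (fun k => (term 1 ω k : ℂ)) (S 1 ω : ℂ) :=
    Complex.hasSum_ofReal.2 (summable_term (by norm_num) hω).hasSum
  have hs := (hasSum_logChar hω θ).summable.hasSum.add (h1.mul_right ((θ : ℂ) ^ 2 / 2))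
  have h2 : HasSum (fun k => 4 * |θ| ^ 3 * term 2 ω k) (4 * |θ| ^ 3 * S 2 ω) :=
    (summable_term (by norm_num) hω).hasSum.mul_left _
  rw [mul_div_assoc, logChar, ← hs.tsum_eq]
  refine tsum_of_norm_bounded h2 fun k => ?_
  have e0 := natCast_mul_term (-1) ω k
  have e1 := natCast_mul_term 0 ω k
  have e2 := natCast_mul_term 1 ω k
  norm_num at e0 e1 e2
  have e : (term (-1) ω k : ℂ) * (Complex.exp (k * θ * Complex.I) - 1 - k * θ * Complex.I) +
      term 1 ω k * ((θ : ℂ) ^ 2 / 2) = term (-1) ω k *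
        (Complex.exp ((k * θ : ℝ) * Complex.I) - 1 - (k * θ : ℝ) * Complex.I +
          ((k * θ : ℝ) : ℂ) ^ 2 / 2) := by
    rw [← e1, ← e0]
    push_cast
    ring
  rw [e, norm_mul, Complex.norm_real, Real.norm_of_nonneg (term_nonneg _ _ _)]
  calc _ ≤ term (-1) ω k * (4 * |k * θ| ^ 3) :=
        mul_le_mul_of_nonneg_left (norm_exp_mul_I_sub_le _) (term_nonneg _ _ _)
    _ = _ := by
      rw [← e2, ← e1, ← e0, abs_mul, Nat.abs_cast]
      ring

/-- The factor `16` makes the cubic error at most half of the quadratic term. This provides the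
dominating Gaussian on the main arc. -/
theorem re_logChar_le_of_abs_le {ω : ℝ} (hω : 0 < ω) {θ : ℝ} (hθ : |θ| ≤ S 1 ω / (16 * S 2 ω)) :
    (logChar ω θ).re ≤ -(S 1 ω * θ ^ 2 / 4) := by
  have h := (Complex.re_le_norm _).trans (norm_logChar_add_le hω θ)
  have e : (logChar ω θ + S 1 ω * θ ^ 2 / 2).re = (logChar ω θ).re + S 1 ω * θ ^ 2 / 2 := by
    rw [Complex.add_re]
    congr 1
    have : (S 1 ω * θ ^ 2 / 2 : ℂ) = ((S 1 ω * θ ^ 2 / 2 : ℝ) : ℂ) := by push_cast; rfl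
    rw [this, Complex.ofReal_re]
  have hS2 : 0 < S 2 ω := S_pos (by norm_num) hω
  rw [le_div_iff₀ (by positivity)] at hθ
  have h3 : 4 * |θ| ^ 3 * S 2 ω ≤ S 1 ω * θ ^ 2 / 4 := by
    rw [← sq_abs θ]
    have := mul_le_mul_of_nonneg_right hθ (sq_nonneg |θ|)
    nlinarith
  linarith

/-- Every term of `-Re logChar` is nonnegative, and `a_k ≥ k` gives `term (-1) ω k ≥ q^k` for `k ≥
1`. The smaller series has the closed form of `hasSum_pow_mul_one_sub_cos`. -/
theorem re_logChar_le_tsum {ω : ℝ} (hω : 0 < ω) (θ : ℝ) :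
    (logChar ω θ).re ≤ -∑' k : ℕ, Real.exp (-1 / ω) ^ k * (1 - Real.cos (k * θ)) := by
  set q := Real.exp (-1 / ω) with hq
  have hq0 : 0 < q := Real.exp_pos _
  have hq1 : q < 1 := by
    rw [hq, Real.exp_lt_one_iff]; exact div_neg_of_neg_of_pos (by norm_num) hω
  have hre := Complex.hasSum_re (hasSum_logChar hω θ).summable.hasSum
  have e : ∀ k : ℕ, ((term (-1) ω k : ℂ) *
      (Complex.exp (k * θ * Complex.I) - 1 - k * θ * Complex.I)).re =
      -(term (-1) ω k * (1 - Real.cos (k * θ))) := fun k => by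
    have : (k * θ * Complex.I : ℂ) = ((k * θ : ℝ) : ℂ) * Complex.I := by push_cast; ring
    rw [Complex.re_ofReal_mul, this, Complex.sub_re, Complex.sub_re, Complex.exp_ofReal_mul_I_re,
      Complex.re_ofReal_mul, Complex.I_re, Complex.one_re]
    ring
  simp only [e] at hre
  have hcos : ∀ k : ℕ, 0 ≤ 1 - Real.cos (k * θ) := fun k => by linarith [Real.cos_le_one (k * θ)]
  have hle : ∀ k : ℕ, q ^ k * (1 - Real.cos (k * θ)) ≤ term (-1) ω k * (1 - Real.cos (k * θ)) := by
    intro k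
    rcases Nat.eq_zero_or_pos k with rfl | hk
    · simp
    · refine mul_le_mul_of_nonneg_right ?_ (hcos k)
      have hk' : (0 : ℝ) < k := by exact_mod_cast hk
      have : (k : ℝ) ≤ divWeight k := by exact_mod_cast le_divWeight k
      rw [term_eq, zpow_neg_one, ← div_eq_mul_inv, hq, ← Real.exp_nat_mul,
        show (k : ℝ) * (-1 / ω) = -k / ω by ring]
      exact le_mul_of_one_le_left (Real.exp_pos _).le ((one_le_div hk').2 this)
  have hs : Summable fun k : ℕ => term (-1) ω k * (1 - Real.cos (k * θ)) :=
    hre.summable.neg.congr fun k => by rw [neg_neg]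
  have hs' : Summable fun k : ℕ => q ^ k * (1 - Real.cos (k * θ)) :=
    .of_nonneg_of_le (fun k => mul_nonneg (by positivity) (hcos k)) hle hs
  have := hs'.tsum_le_tsum hle hs
  rw [logChar, ← hre.tsum_eq, tsum_neg]
  linarith

theorem hasSum_pow_mul_one_sub_cos {q : ℝ} (hq0 : 0 < q) (hq1 : q < 1) (θ : ℝ) :
    HasSum (fun k : ℕ => q ^ k * (1 - Real.cos (k * θ)))
      (q * (1 + q) * (1 - Real.cos θ) /
        ((1 - q) * ((1 - q) ^ 2 + 2 * q * (1 - Real.cos θ)))) := by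
  have h1 := hasSum_geometric_of_lt_one hq0.le hq1
  have hz : ‖(q * Complex.exp (θ * Complex.I) : ℂ)‖ < 1 := by
    rwa [norm_mul, Complex.norm_exp_ofReal_mul_I, mul_one, Complex.norm_real,
      Real.norm_of_nonneg hq0.le]
  have h2 := Complex.hasSum_re (hasSum_geometric_of_norm_lt_one hz)
  have hq : 0 < 1 - q := by linarith
  have hc : 0 ≤ 1 - Real.cos θ := by linarith [Real.cos_le_one θ]
  have hden : 0 < (1 - q) ^ 2 + 2 * q * (1 - Real.cos θ) := by positivity
  have e1 : ∀ k : ℕ, ((q * Complex.exp (θ * Complex.I) : ℂ) ^ k).re = q ^ k * Real.cos (k * θ) :=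
    fun k => by
      rw [mul_pow, ← Complex.exp_nat_mul, ← Complex.ofReal_pow, Complex.re_ofReal_mul,
        ← mul_assoc, ← Complex.ofReal_natCast, ← Complex.ofReal_mul, Complex.exp_ofReal_mul_I_re]
  have e2 : ((1 - q * Complex.exp (θ * Complex.I) : ℂ)⁻¹).re =
      (1 - q * Real.cos θ) / ((1 - q) ^ 2 + 2 * q * (1 - Real.cos θ)) := by
    rw [Complex.inv_re, Complex.normSq_apply, Complex.sub_re, Complex.sub_im,
      Complex.re_ofReal_mul, Complex.im_ofReal_mul, Complex.exp_ofReal_mul_I_re,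
      Complex.exp_ofReal_mul_I_im, Complex.one_re, Complex.one_im]
    congr 1
    linear_combination q ^ 2 * Real.sin_sq_add_cos_sq θ
  simp only [e1, e2] at h2
  have h3 := h1.sub h2
  have e3 : (1 - q)⁻¹ - (1 - q * Real.cos θ) / ((1 - q) ^ 2 + 2 * q * (1 - Real.cos θ)) =
      q * (1 + q) * (1 - Real.cos θ) /
        ((1 - q) * ((1 - q) ^ 2 + 2 * q * (1 - Real.cos θ))) := by
    field_simp
    ring
  rw [e3] at h3
  exact Eq.subst (motive := fun f => HasSum f _) (funext fun k => by ring) h3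

theorem re_logChar_le_of_le_one_sub_cos {ω τ θ : ℝ} (hω : 2 ≤ ω) (hτ0 : 0 ≤ τ)
    (hτ : τ ≤ 1 / ω ^ 2) (hθ : τ ≤ 1 - Real.cos θ) :
    (logChar ω θ).re ≤ -(τ * ω ^ 3 / 4) := by
  have hω0 : 0 < ω := by linarith
  refine (re_logChar_le_tsum hω0 θ).trans (neg_le_neg ?_)
  set q := Real.exp (-1 / ω) with hq
  have hq0 : 0 < q := Real.exp_pos _
  have hq1 : q < 1 := by
    rw [hq, Real.exp_lt_one_iff]; exact div_neg_of_neg_of_pos (by norm_num) hω0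
  have hq2 : 1 - 1 / ω ≤ q := by
    have := Real.add_one_le_exp (-1 / ω)
    rw [neg_div] at this
    rw [hq, neg_div]; linarith
  have hω2 : 1 / ω ≤ 1 / 2 := one_div_le_one_div_of_le (by norm_num) hω
  rw [(hasSum_pow_mul_one_sub_cos hq0 hq1 θ).tsum_eq]
  generalize 1 - Real.cos θ = t at hθ
  have ht : 0 ≤ t := hτ0.trans hθ
  have hr0 : 0 < 1 - q := by linarith
  set r := 1 / ω with hr
  have hrpos : 0 < r := by positivity
  have hωr : ω ^ 3 = 1 / r ^ 3 := by rw [hr]; field_simp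
  have hτr : τ ≤ r ^ 2 := by rw [hr, div_pow, one_pow]; exact hτ
  have h1 : (1 - q) ^ 2 + 2 * q * t ≤ r ^ 2 + 2 * t := by
    have : (1 - q) ^ 2 ≤ r ^ 2 := by gcongr; linarith
    nlinarith
  have h2 : (1 - q) * ((1 - q) ^ 2 + 2 * q * t) ≤ r * (r ^ 2 + 2 * t) := by
    gcongr
    linarith
  have h3 : (3 / 4 : ℝ) ≤ q * (1 + q) := by nlinarith
  calc τ * ω ^ 3 / 4 = τ / (4 * r ^ 3) := by rw [hωr]; field_simp
    _ ≤ 3 / 4 * t / (r * (r ^ 2 + 2 * t)) := by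
      rw [div_le_div_iff₀ (by positivity) (by positivity)]
      -- Uses `τ ≤ t` on the first summand and `τ ≤ r²` on the second.
      have h5 : τ * (r ^ 2 + 2 * t) ≤ 3 * t * r ^ 2 := by nlinarith
      nlinarith
    _ ≤ _ := by
      apply div_le_div₀ (by positivity) (by gcongr) (by positivity) h2

/-! ### Asymptotics of the integral: the main arc and its complement -/

/-- The main arc `|θ| ≤ S₁ / (16 S₂)` is not too short. -/
theorem exists_le_S_one_div_S_two :
    ∃ c : ℝ, 0 < c ∧ c ≤ 1 ∧ ∀ ω : ℝ, 2 ≤ ω → c * ω ^ (-(5 / 4) : ℝ) ≤ S 1 ω / (16 * S 2 ω) := by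
  obtain ⟨C, hC, hS⟩ := exists_S_le (m := 2) (by norm_num)
  refine ⟨min 1 (1 / (32 * C)), by positivity, min_le_left _ _, fun ω hω => ?_⟩
  have hω0 : 0 < ω := by linarith
  have hS2 : 0 < S 2 ω := S_pos (by norm_num) hω0
  have h2 := hS ω hω0
  have h1 := cube_le_S_one hω
  rw [le_div_iff₀ (by positivity)]
  have e : ω ^ (-(5 / 4) : ℝ) * ω ^ (((2 : ℤ) : ℝ) + 9 / 4 : ℝ) = ω ^ 3 := by
    rw [← Real.rpow_add hω0, ← Real.rpow_natCast]; norm_num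
  calc _ ≤ 1 / (32 * C) * ω ^ (-(5 / 4) : ℝ) * (16 * (C * ω ^ (((2 : ℤ) : ℝ) + 9 / 4 : ℝ))) := by
        gcongr
        exact min_le_right _ _
    _ = (ω ^ (-(5 / 4) : ℝ) * ω ^ (((2 : ℤ) : ℝ) + 9 / 4 : ℝ)) / 2 := by field_simp; ring
    _ ≤ S 1 ω := by rw [e]; exact h1

theorem norm_exp_logChar (ω θ : ℝ) :
    ‖Complex.exp (logChar ω θ)‖ = Real.exp (logChar ω θ).re := Complex.norm_exp _

/-- After rescaling by `√S_1` the main arc exhausts the real line: its half-length is at least of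
order `ω^{3/2} · ω^{-5/4} = ω^{1/4}`. -/
theorem tendsto_sqrt_S_one_mul_arc :
    Tendsto (fun ω => √(S 1 ω) * (S 1 ω / (16 * S 2 ω))) atTop atTop := by
  obtain ⟨c, hc0, -, hc⟩ := exists_le_S_one_div_S_two
  have ht : Tendsto (fun ω : ℝ => c / 2 * ω ^ (1 / 4 : ℝ)) atTop atTop :=
    (tendsto_rpow_atTop (by norm_num)).const_mul_atTop (by positivity)
  refine tendsto_atTop_mono' _ ?_ ht
  filter_upwards [eventually_ge_atTop 2] with ω hω
  have hω0 : 0 < ω := by linarith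
  have h1 : ω ^ (3 / 2 : ℝ) / 2 ≤ √(S 1 ω) := by
    refine Real.le_sqrt_of_sq_le ?_
    have e : (ω ^ (3 / 2 : ℝ)) ^ 2 = ω ^ 3 := by
      rw [← Real.rpow_natCast, ← Real.rpow_mul hω0.le, ← Real.rpow_natCast]; norm_num
    have := cube_le_S_one hω
    have : 0 ≤ ω ^ 3 := by positivity
    rw [div_pow, e]
    linarith
  have e : ω ^ (1 / 4 : ℝ) = ω ^ (3 / 2 : ℝ) * ω ^ (-(5 / 4) : ℝ) := by
    rw [← Real.rpow_add hω0]; norm_num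
  calc c / 2 * ω ^ (1 / 4 : ℝ) = ω ^ (3 / 2 : ℝ) / 2 * (c * ω ^ (-(5 / 4) : ℝ)) := by rw [e]; ring
    _ ≤ _ := by
      gcongr
      exact hc ω hω

theorem tendsto_integral_main_arc :
    Tendsto (fun ω => (√(S 1 ω) : ℂ) * ∫ θ in -(S 1 ω / (16 * S 2 ω))..(S 1 ω / (16 * S 2 ω)),
      Complex.exp (logChar ω θ)) atTop (𝓝 (√(2 * Real.pi) : ℂ)) := by
  set T : ℝ → ℝ := fun ω => √(S 1 ω) * (S 1 ω / (16 * S 2 ω)) with hT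
  have hlim : Tendsto (fun ω => ∫ u : ℝ, (Set.Ioc (-T ω) (T ω)).indicator
      (fun u => Complex.exp (logChar ω (u / √(S 1 ω)))) u) atTop
      (𝓝 (∫ u : ℝ, Complex.exp ((-(1 / 2) * u ^ 2 : ℝ)))) := by
    refine MeasureTheory.tendsto_integral_filter_of_dominated_convergence
      (fun u => Real.exp (-(1 / 4) * u ^ 2)) ?_ ?_ (integrable_exp_neg_mul_sq (by norm_num)) ?_
    · filter_upwards [eventually_gt_atTop 0] with ω hω
      have := continuous_logChar hω
      exact (Continuous.aestronglyMeasurable (by fun_prop)).indicator measurableSet_Ioc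
    · filter_upwards [eventually_gt_atTop 0] with ω hω
      refine .of_forall fun u => ?_
      have hS1 : 0 < S 1 ω := S_pos (by norm_num) hω
      have hsq : 0 < √(S 1 ω) := Real.sqrt_pos.2 hS1
      by_cases hu : u ∈ Set.Ioc (-T ω) (T ω)
      · rw [Set.indicator_of_mem hu, norm_exp_logChar, Real.exp_le_exp]
        refine (re_logChar_le_of_abs_le hω ?_).trans_eq ?_
        · rw [abs_div, abs_of_pos hsq, div_le_iff₀ hsq, mul_comm]
          exact abs_le.2 ⟨hu.1.le, hu.2⟩
        · rw [div_pow, Real.sq_sqrt hS1.le]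
          field_simp
      · rw [Set.indicator_of_notMem hu, norm_zero]
        exact (Real.exp_pos _).le
    · refine .of_forall fun u => ?_
      have hev : ∀ᶠ ω in atTop, Complex.exp (logChar ω (u / √(S 1 ω))) =
          (Set.Ioc (-T ω) (T ω)).indicator
            (fun u => Complex.exp (logChar ω (u / √(S 1 ω)))) u := by
        filter_upwards [tendsto_sqrt_S_one_mul_arc.eventually_gt_atTop |u|] with ω hω
        rw [Set.indicator_of_mem]
        exact ⟨(abs_lt.1 hω).1, (abs_lt.1 hω).2.le⟩
      refine Tendsto.congr' hev ?_
      refine (Complex.continuous_exp.tendsto _).comp ?_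
      rw [tendsto_iff_norm_sub_tendsto_zero]
      -- At `θ = u/√S_1` the cubic error `4 |θ|³ S_2` equals `|u|³ / (4 T)`.
      have h0 : Tendsto (fun ω => |u| ^ 3 / 4 * (T ω)⁻¹) atTop (𝓝 0) := by
        have := tendsto_sqrt_S_one_mul_arc.inv_tendsto_atTop.const_mul (|u| ^ 3 / 4)
        rwa [mul_zero] at this
      refine squeeze_zero' (.of_forall fun _ => norm_nonneg _) ?_ h0
      filter_upwards [eventually_gt_atTop 0] with ω hω
      have hS1 : 0 < S 1 ω := S_pos (by norm_num) hω
      have hS2 : 0 < S 2 ω := S_pos (by norm_num) hω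
      have hsq : 0 < √(S 1 ω) := Real.sqrt_pos.2 hS1
      have h := norm_logChar_add_le hω (u / √(S 1 ω))
      have hss : √(S 1 ω) ^ 2 = S 1 ω := Real.sq_sqrt hS1.le
      have e1 : (S 1 ω : ℂ) * ((u / √(S 1 ω) : ℝ) : ℂ) ^ 2 / 2 = -((-(1 / 2) * u ^ 2 : ℝ) : ℂ) := by
        rw [← Complex.ofReal_pow, div_pow, hss]
        have : (S 1 ω : ℂ) ≠ 0 := by exact_mod_cast hS1.ne'
        push_cast
        field_simp
      rw [e1, ← sub_eq_add_neg] at h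
      refine h.trans_eq ?_
      rw [abs_div, abs_of_pos hsq, div_pow, pow_succ (√(S 1 ω)), hss, hT]
      field_simp
      ring
  have hgauss : ∫ u : ℝ, Complex.exp ((-(1 / 2) * u ^ 2 : ℝ)) = (√(2 * Real.pi) : ℂ) := by
    simp only [← Complex.ofReal_exp]
    rw [integral_complex_ofReal, integral_gaussian]
    congr 2
    ring
  rw [hgauss] at hlim
  refine hlim.congr' ?_
  filter_upwards [eventually_gt_atTop 0] with ω hω
  have hS1 : 0 < S 1 ω := S_pos (by norm_num) hω
  have hS2 : 0 < S 2 ω := S_pos (by norm_num) hω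
  have hsq : 0 < √(S 1 ω) := Real.sqrt_pos.2 hS1
  have hT0 : 0 ≤ T ω := by positivity
  rw [MeasureTheory.integral_indicator measurableSet_Ioc,
    ← intervalIntegral.integral_of_le (by linarith),
    intervalIntegral.integral_comp_div (fun θ => Complex.exp (logChar ω θ)) hsq.ne', neg_div,
    hT, mul_div_cancel_left₀ _ hsq.ne', Complex.real_smul]

theorem exists_norm_integral_sub_le :
    ∃ c : ℝ, 0 < c ∧ ∀ ω : ℝ, 2 ≤ ω →
      ‖(∫ θ in -Real.pi..Real.pi, Complex.exp (logChar ω θ)) -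
        ∫ θ in -(S 1 ω / (16 * S 2 ω))..(S 1 ω / (16 * S 2 ω)), Complex.exp (logChar ω θ)‖ ≤
      2 * Real.pi * Real.exp (-c * ω ^ (1 / 2 : ℝ)) := by
  obtain ⟨c, hc0, hc1, hc⟩ := exists_le_S_one_div_S_two
  refine ⟨c ^ 2 / 20, by positivity, fun ω hω => ?_⟩
  have hω0 : 0 < ω := by linarith
  have hS1 : 0 < S 1 ω := S_pos (by norm_num) hω0
  have hS2 : 0 < S 2 ω := S_pos (by norm_num) hω0
  have hcω := hc ω hω
  set δ := S 1 ω / (16 * S 2 ω) with hδ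
  have hδ0 : 0 < δ := by positivity
  -- This keeps the main arc inside `[-π, π]`.
  have hδ1 : δ ≤ 1 := by
    rw [hδ, div_le_one (by positivity)]
    have h12 : S 1 ω ≤ S 2 ω := S_mono_index (m := 1) (by norm_num) hω0
    linarith
  have hπ := Real.pi_gt_three
  have hpt : ∀ θ : ℝ, δ ≤ |θ| → |θ| ≤ Real.pi →
      ‖Complex.exp (logChar ω θ)‖ ≤ Real.exp (-(c ^ 2 / 20) * ω ^ (1 / 2 : ℝ)) := by
    intro θ h1 h2
    rw [norm_exp_logChar, Real.exp_le_exp]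
    have e : (ω ^ (-(5 / 4) : ℝ)) ^ 2 = ω ^ (-(5 / 2) : ℝ) := by
      rw [← Real.rpow_natCast, ← Real.rpow_mul hω0.le]; norm_num
    have e2 : ω ^ (-(5 / 2) : ℝ) * ω ^ 3 = ω ^ (1 / 2 : ℝ) := by
      rw [← Real.rpow_natCast ω 3, ← Real.rpow_add hω0]; norm_num
    -- The threshold is `τ = (c²/5) ω^{-5/2}`: off the main arc `|θ| ≥ c ω^{-5/4}`, and `1 - cos θ ≥
    -- 2θ²/π² ≥ θ²/5`. Then `τ ω³/4 = (c²/20) ω^{1/2}`.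
    have hτ : c ^ 2 / 5 * ω ^ (-(5 / 2) : ℝ) ≤ 1 / ω ^ 2 := by
      have h3 : ω ^ (-(5 / 2) : ℝ) ≤ 1 / ω ^ 2 := by
        rw [one_div, ← Real.rpow_natCast, ← Real.rpow_neg hω0.le]
        exact Real.rpow_le_rpow_of_exponent_le (by linarith) (by norm_num)
      refine le_trans (mul_le_of_le_one_left (by positivity) ?_) h3
      nlinarith
    have hcos : c ^ 2 / 5 * ω ^ (-(5 / 2) : ℝ) ≤ 1 - Real.cos θ := by
      have h4 := Real.cos_le_one_sub_mul_cos_sq h2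
      have h5 : (c * ω ^ (-(5 / 4) : ℝ)) ^ 2 ≤ θ ^ 2 := by
        rw [← sq_abs θ]
        exact pow_le_pow_left₀ (by positivity) (hcω.trans h1) 2
      have h6 : (1 / 5 : ℝ) ≤ 2 / Real.pi ^ 2 := by
        rw [div_le_div_iff₀ (by norm_num) (by positivity)]
        nlinarith [Real.pi_lt_d2]
      have h7 : 1 / 5 * (c * ω ^ (-(5 / 4) : ℝ)) ^ 2 ≤ 2 / Real.pi ^ 2 * θ ^ 2 := by gcongr
      rw [mul_pow, e] at h7
      linarith
    refine (re_logChar_le_of_le_one_sub_cos hω (by positivity) hτ hcos).trans_eq ?_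
    rw [← e2]
    ring
  have hcont : Continuous fun θ => Complex.exp (logChar ω θ) :=
    Complex.continuous_exp.comp (continuous_logChar hω0)
  have hsplit : (∫ θ in -Real.pi..Real.pi, Complex.exp (logChar ω θ)) -
      (∫ θ in -δ..δ, Complex.exp (logChar ω θ)) =
      (∫ θ in -Real.pi..-δ, Complex.exp (logChar ω θ)) +
        ∫ θ in δ..Real.pi, Complex.exp (logChar ω θ) := by
    rw [← intervalIntegral.integral_add_adjacent_intervals (hcont.intervalIntegrable _ (-δ))
      (hcont.intervalIntegrable _ Real.pi),
      ← intervalIntegral.integral_add_adjacent_intervals (hcont.intervalIntegrable (-δ) δ)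
      (hcont.intervalIntegrable _ Real.pi)]
    ring
  have hleft : ‖∫ θ in -Real.pi..-δ, Complex.exp (logChar ω θ)‖ ≤
      Real.exp (-(c ^ 2 / 20) * ω ^ (1 / 2 : ℝ)) * |-δ - -Real.pi| := by
    refine intervalIntegral.norm_integral_le_of_norm_le_const fun θ hθ => ?_
    rw [Set.uIoc_of_le (by linarith)] at hθ
    have : |θ| = -θ := abs_of_nonpos (by linarith [hθ.2])
    exact hpt θ (by linarith [hθ.2]) (by linarith [hθ.1])
  have hright : ‖∫ θ in δ..Real.pi, Complex.exp (logChar ω θ)‖ ≤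
      Real.exp (-(c ^ 2 / 20) * ω ^ (1 / 2 : ℝ)) * |Real.pi - δ| := by
    refine intervalIntegral.norm_integral_le_of_norm_le_const fun θ hθ => ?_
    rw [Set.uIoc_of_le (by linarith)] at hθ
    have : |θ| = θ := abs_of_nonneg (by linarith [hθ.1])
    exact hpt θ (by linarith [hθ.1]) (by linarith [hθ.2])
  rw [abs_of_nonneg (by linarith)] at hleft hright
  have hE := Real.exp_pos (-(c ^ 2 / 20) * ω ^ (1 / 2 : ℝ))
  rw [hsplit]
  refine (norm_add_le _ _).trans ((add_le_add hleft hright).trans ?_)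
  nlinarith

theorem tendsto_integral_exp_logChar :
    Tendsto (fun ω => (√(S 1 ω) : ℂ) * ∫ θ in -Real.pi..Real.pi, Complex.exp (logChar ω θ))
      atTop (𝓝 (√(2 * Real.pi) : ℂ)) := by
  obtain ⟨c, hc0, hc⟩ := exists_norm_integral_sub_le
  obtain ⟨C, hC0, hC⟩ := exists_S_le (m := 1) (by norm_num)
  have hdiff : Tendsto (fun ω => (√(S 1 ω) : ℂ) *
      ((∫ θ in -Real.pi..Real.pi, Complex.exp (logChar ω θ)) -
        ∫ θ in -(S 1 ω / (16 * S 2 ω))..(S 1 ω / (16 * S 2 ω)), Complex.exp (logChar ω θ)))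
      atTop (𝓝 0) := by
    have h0 : Tendsto (fun ω : ℝ => C * (2 * Real.pi) * ((ω ^ (1 / 2 : ℝ)) ^ (13 / 2 : ℝ) *
        Real.exp (-c * ω ^ (1 / 2 : ℝ)))) atTop (𝓝 0) := by
      simpa using ((tendsto_rpow_mul_exp_neg_mul_atTop_nhds_zero (13 / 2) c hc0).comp
        (tendsto_rpow_atTop (show (0 : ℝ) < 1 / 2 by norm_num))).const_mul (C * (2 * Real.pi))
    refine squeeze_zero_norm' ?_ h0
    filter_upwards [eventually_ge_atTop 2] with ω hω
    have hω0 : 0 < ω := by linarith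
    have h1 : 1 ≤ S 1 ω := by
      have h8 : (2 : ℝ) ^ 3 ≤ ω ^ 3 := by gcongr
      linarith [cube_le_S_one hω]
    -- The bound `C ω^{13/4}` is written in powers of `√ω`, the variable in which the complementary
    -- arcs decay exponentially.
    have h2 : √(S 1 ω) ≤ C * (ω ^ (1 / 2 : ℝ)) ^ (13 / 2 : ℝ) := by
      rw [← Real.rpow_mul hω0.le]
      calc √(S 1 ω) ≤ S 1 ω := Real.sqrt_le_self_iff.2 (Or.inr h1)
        _ ≤ _ := hC ω hω0
        _ = _ := by norm_num
    rw [norm_mul, Complex.norm_real, Real.norm_of_nonneg (Real.sqrt_nonneg _)]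
    calc _ ≤ (C * (ω ^ (1 / 2 : ℝ)) ^ (13 / 2 : ℝ)) *
          (2 * Real.pi * Real.exp (-c * ω ^ (1 / 2 : ℝ))) := by
          gcongr
          exact hc ω hω
      _ = _ := by ring
  have := hdiff.add tendsto_integral_main_arc
  rw [zero_add] at this
  exact this.congr fun ω => by ring

/-! ### The asymptotic formula along `ω(n) → ∞` -/

theorem tendsto_p_div {ω : ℕ → ℝ} (h : ∀ n : ℕ, 1 ≤ n → 0 < ω n ∧ S 0 (ω n) = n) :
    Tendsto (fun n : ℕ => (p n : ℝ) / (1 / √(2 * Real.pi * S 1 (ω n)) *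
      Real.exp (S (-1) (ω n) + (n : ℝ) / ω n))) atTop (𝓝 1) := by
  have hlim := (tendsto_integral_exp_logChar.comp (tendsto_atTop_of_S_zero_eq h)).const_mul
    ((√(2 * Real.pi) : ℂ)⁻¹)
  have hπ : 0 < √(2 * Real.pi) := Real.sqrt_pos.2 (by positivity)
  have hπ' : (√(2 * Real.pi) : ℂ) ≠ 0 := by exact_mod_cast hπ.ne'
  rw [inv_mul_cancel₀ hπ'] at hlim
  have hre := (Complex.continuous_re.tendsto _).comp hlim
  rw [Complex.one_re] at hre
  refine hre.congr' ?_
  filter_upwards [eventually_ge_atTop 1] with n hn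
  obtain ⟨hω, hSn⟩ := h n hn
  have hS1 : 0 < S 1 (ω n) := S_pos (by norm_num) hω
  have hp := p_mul_exp_eq_integral hω hSn
  have hE : Complex.exp (S (-1) (ω n)) ≠ 0 := Complex.exp_ne_zero _
  have hJ : ∫ θ in -Real.pi..Real.pi, Complex.exp (logChar (ω n) θ) =
      ((2 * Real.pi * (p n * Real.exp (-n / ω n)) / Real.exp (S (-1) (ω n)) : ℝ) : ℂ) := by
    push_cast
    rw [eq_div_iff hE, mul_comm, ← hp]
    push_cast
    rfl
  simp only [Function.comp]
  rw [hJ, ← Complex.ofReal_mul, ← Complex.ofReal_inv, ← Complex.ofReal_mul, Complex.ofReal_re,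
    Real.sqrt_mul (show 0 ≤ 2 * Real.pi by positivity) (S 1 (ω n)), Real.exp_add, neg_div, Real.exp_neg]
  have h2 : √(2 * Real.pi) ^ 2 = 2 * Real.pi := Real.sq_sqrt (by positivity)
  have hsq : 0 < √(S 1 (ω n)) := Real.sqrt_pos.2 hS1
  generalize √(2 * Real.pi) = t at hπ h2
  rw [← h2]
  field_simp

end GeneralizedPartition

theorem mainTheorem7 :
    -- the series `S_m(ω)` converge absolutely (their terms are nonnegative)
    (∀ m : ℤ, -1 ≤ m → ∀ ω : ℝ, 0 < ω → Summable (GeneralizedPartition.term m ω)) ∧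
    -- `S_0(ω) = n` has a unique solution in `(0, ∞)`
    (∀ n : ℕ, 1 ≤ n → ∃! ω : ℝ, 0 < ω ∧ GeneralizedPartition.S 0 ω = n) ∧
    -- the asymptotic formula at that solution
    (∀ ω : ℕ → ℝ, (∀ n : ℕ, 1 ≤ n → 0 < ω n ∧ GeneralizedPartition.S 0 (ω n) = n) →
      Filter.Tendsto
        (fun n : ℕ => (GeneralizedPartition.p n : ℝ) /
          (1 / Real.sqrt (2 * Real.pi * GeneralizedPartition.S 1 (ω n)) *
            Real.exp (GeneralizedPartition.S (-1) (ω n) + (n : ℝ) / ω n)))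
        Filter.atTop (nhds 1)) := by
  exact ⟨fun _ hm _ hω => GeneralizedPartition.summable_term hm hω,
    fun _ hn => GeneralizedPartition.existsUnique_S_zero_eq hn,
    fun _ h => GeneralizedPartition.tendsto_p_div h⟩
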